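/- Let $K\neq 0$ be a real number and put $\kappa=\sqrt{|K|}$. In a metric space $(M,\rho)$, a *shortest* joining $P$ to $Q$ is a curve joining $P$ to $Q$ whose length is $\rho(P,Q)$. A *geodesic triangle* consists of three distinct points and three shortests joining them pairwise. For a triple $X,O,Y$ with $X,Y\ne O$ (and $\rho(O,X)+\rho(O,Y)+\rho(X,Y)<2\pi/\sqrt K$ if $K>0$), let $\measuredangle_K XOY$ be the angle at the vertex corresponding to $O$ of the triangle with the same side lengths in the $K$-plane $\mathbb S_K$ (the complete simply connected surface of constant curvature $K$). The *upper angle* at $O$ between shortests $\mathcal L,\mathcal N$ starting at $O$ is $\limsup \measuredangle_K XOY$ as $X\in\mathcal L\setminus\{O\}$ and $Y\in\mathcal N\setminus\{O\}$ tend to $O$. The *$K$-excess* of a geodesic triangle $ABC$ is the sum of its three upper angles (between its sides at its vertices) minus $\measuredangle_K BAC+\measuredangle_K ABC+\measuredangle_K ACB$. An *$\Re_K$ domain* is a metric space such that (i) any two points can be joined by a shortest; (ii) if $K>0$, every geodesic triangle has perimeter less than $2\pi/\sqrt K$; (iii) every geodesic triangle has non-positive $K$-excess. **Theorem ($K$-Euler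 inequality).** Let $K\neq0$ and let $A,B,C,D$ be four distinct points of an $\Re_K$ domain $(M,\rho)$. If $K>0$, assume that $\rho(A,B)+\rho(B,C)+\rho(C,D)+\rho(D,A)<2\pi/\sqrt K$. Put $$a=\rho(A,B),\quad b=\rho(B,C),\quad c=\rho(C,D),\quad d=\rho(A,D),\quad e=\rho(B,D),\quad f=\rho(A,C).$$ (a) If $K>0$, then $$\cos\kappa a+\cos\kappa b+\cos\kappa c+\cos\kappa d\le 4\cos\frac{\kappa e}{2}\cos\frac{\kappa f}{2}.$$ (b) If $K<0$, then $$\cosh\kappa a+\cosh\kappa b+\cosh\kappa c+\cosh\kappa d\ge 4\cosh\frac{\kappa e}{2}\cosh\frac{\kappa f}{2}.$$ -/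

import Mathlib

open Real Set Filter Topology

noncomputable section

/-- `κ = √|K|`. -/
def kappa (K : ℝ) : ℝ := √|K|

/-- Let `x`, `y`, `z` be the side lengths of a triangle in the `K`-plane (the simply connected
complete surface of constant curvature `K`), with `x, y > 0` and `x + y + z < 2 π / √K` if `K > 0`.
This is the angle, in `[0, π]`, between the sides of lengths `x` and `y` (that is, opposite to the
side of length `z`); it is determined by the spherical, hyperbolic or Euclidean law of cosines:
`cos κz = cos κx cos κy + sin κx sin κy cos θ` if `K > 0`,
`cosh κz = cosh κx cosh κy - sinh κx sinh κy cos θ` if `K < 0`,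
`z² = x² + y² - 2 x y cos θ` if `K = 0`. -/
def modelAngle (K x y z : ℝ) : ℝ :=
  if 0 < K then
    arccos ((cos (kappa K * z) - cos (kappa K * x) * cos (kappa K * y)) /
      (sin (kappa K * x) * sin (kappa K * y)))
  else if K < 0 then
    arccos ((cosh (kappa K * x) * cosh (kappa K * y) - cosh (kappa K * z)) /
      (sinh (kappa K * x) * sinh (kappa K * y)))
  else
    arccos ((x ^ 2 + y ^ 2 - z ^ 2) / (2 * x * y))

section Metric

variable {M : Type*} [MetricSpace M]

/-- The comparison angle `∡_K X O Y`: the angle at the vertex corresponding to `O` in the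
isometric copy in the `K`-plane of the triple `X`, `O`, `Y`. -/
def comparisonAngle (K : ℝ) (X O Y : M) : ℝ :=
  modelAngle K (dist O X) (dist O Y) (dist X Y)

/-- `L` is (the set of points of) a shortest joining `P` to `Q`: a curve joining `P` to `Q` whose
length is the distance between `P` and `Q`. -/
def IsShortest (L : Set M) (P Q : M) : Prop :=
  ∃ γ : Path P Q, eVariationOn γ univ = edist P Q ∧ L = range γ

/-- The upper angle at `O` between two shortests `L` and `N` starting at `O`: the upper limit of
`∡_K X O Y` as `X ∈ L \ {O}` and `Y ∈ N \ {O}` tend to `O`. -/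
def upperAngle (K : ℝ) (O : M) (L N : Set M) : ℝ :=
  limsup (fun p : M × M => comparisonAngle K p.1 O p.2) (𝓝[L \ {O}] O ×ˢ 𝓝[N \ {O}] O)

end Metric

/-- A geodesic triangle: three distinct points together with three shortests joining them. -/
structure GeodesicTriangle (M : Type*) [MetricSpace M] where
  A : M
  B : M
  C : M
  sideAB : Set M
  sideBC : Set M
  sideCA : Set M
  hAB : A ≠ B
  hBC : B ≠ C
  hCA : C ≠ A
  shortestAB : IsShortest sideAB A B
  shortestBC : IsShortest sideBC B C
  shortestCA : IsShortest sideCA C A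

namespace GeodesicTriangle

variable {M : Type*} [MetricSpace M]

def perimeter (T : GeodesicTriangle M) : ℝ :=
  dist T.A T.B + dist T.B T.C + dist T.C T.A

/-- The (upper) `K`-excess: the sum of the three upper angles minus the sum of the three angles of
the isometric copy in the `K`-plane. -/
def excess (K : ℝ) (T : GeodesicTriangle M) : ℝ :=
  (upperAngle K T.A T.sideAB T.sideCA + upperAngle K T.B T.sideAB T.sideBC
      + upperAngle K T.C T.sideBC T.sideCA)
    - (comparisonAngle K T.B T.A T.C + comparisonAngle K T.A T.B T.C
      + comparisonAngle K T.A T.C T.B)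

end GeodesicTriangle

/-- The metric space `M` is an `ℜ_K` domain (in the sense of Aleksandrov). -/
structure IsReDomain (K : ℝ) (M : Type*) [MetricSpace M] : Prop where
  exists_shortest : ∀ P Q : M, ∃ L : Set M, IsShortest L P Q
  perimeter_lt : 0 < K → ∀ T : GeodesicTriangle M, T.perimeter < 2 * π / √K
  excess_nonpos : ∀ T : GeodesicTriangle M, T.excess K ≤ 0

end

/-!
Let `P` be the midpoint of a shortest from `B` to `D`. The inequality follows from the comparison of
medians in the triangles `A B D` and `C B D`, `IsReDomain.median`: for `K = 1` this says that
`cos AB + cos AD ≤ 2 cos (BD / 2) cos AP`, and likewise for `C`. Adding the two and using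
`cos AP + cos CP ≤ 2 cos (AC / 2)`, a consequence of `AP + PC ≥ AC`, gives the claim.

The comparison of medians rests on Aleksandrov's angle comparison, `IsReDomain.upperAngle_le`: in
every geodesic triangle, each upper angle is at most the corresponding angle of the comparison
triangle. At the midpoint `P`, the two upper angles between `P A` and the halves of `B D` have
cosines with non-positive sum, by the first variation inequality; hence so have the two comparison
angles, and the law of cosines does the rest.

The angle comparison is derived from the excess condition, which controls only sums of three angles,
as follows. Let `α` be the upper angle at the origin `O` of two shortests, and let `γ (s, t)` be the
comparison angle at `O` for the points `X`, `Y` at distances `s`, `t` from `O`. For `c > 0` the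
function `γ (s, t) - c (log s + log t)` has a minimum `(s, t)`, because the logarithms tend to `-∞`
at the axes and `γ` is bounded. There `γ` decreases at a rate of at most `c / s` as `X` moves towards
`O`, and at most `c / t` as `Y` does. On the other hand the first variation inequality
(`IsReDomain.first_variation`) bounds the distance from the moving point to the fixed one in terms
of the upper angle `ξ` at `X`; comparing the two gives `cos ξ - cos ξ' ≤ O(c) sin ξ'`, hence
`ξ' - ξ ≤ O(c)`, for the comparison angle `ξ'` at `X` (`IsReDomain.cos_sub_cos_le`), and similarly at
`Y`. Non-positivity of the excess of the triangle `O X Y` now yields `α ≤ γ (s, t) + O(c)`, and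
`γ (s, t)` is at most the comparison angle of the whole triangle, because `log s` and `log t` are
not larger than at the endpoints. Finally let `c → 0`.

Both signs of `K` are treated together by means of the functions `modelCos K` and `modelSin K`;
inequalities between values of `modelCos K` are divided by `K`, so that they do not depend on the
sign.
-/

/-! ### Trigonometry of the `K`-plane -/

lemma kappa_pos {K : ℝ} (hK : K ≠ 0) : 0 < kappa K :=
  Real.sqrt_pos.2 (abs_pos.2 hK)

lemma kappa_sq_of_pos {K : ℝ} (hK : 0 < K) : kappa K ^ 2 = K := by
  rw [kappa, Real.sq_sqrt (abs_nonneg K), abs_of_pos hK]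

lemma kappa_sq_of_not_pos {K : ℝ} (hK : ¬ 0 < K) : kappa K ^ 2 = -K := by
  rw [kappa, Real.sq_sqrt (abs_nonneg K), abs_of_nonpos (not_lt.1 hK)]

/-- The solution of `f'' = -K f`, `f 0 = 1`, `f' 0 = 0` (for `K ≠ 0`). -/
noncomputable def modelCos (K t : ℝ) : ℝ :=
  if 0 < K then cos (kappa K * t) else cosh (kappa K * t)

/-- The solution of `f'' = -K f`, `f 0 = 0`, `f' 0 = 1` (for `K ≠ 0`). -/
noncomputable def modelSin (K t : ℝ) : ℝ :=
  if 0 < K then sin (kappa K * t) / kappa K else sinh (kappa K * t) / kappa K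

lemma modelCos_zero (K : ℝ) : modelCos K 0 = 1 := by simp [modelCos]

lemma modelSin_zero (K : ℝ) : modelSin K 0 = 0 := by simp [modelSin]

lemma modelCos_neg (K t : ℝ) : modelCos K (-t) = modelCos K t := by simp [modelCos]

lemma modelSin_neg (K t : ℝ) : modelSin K (-t) = -modelSin K t := by
  simp only [modelSin, mul_neg, Real.sin_neg, Real.sinh_neg, neg_div]
  split_ifs <;> rfl

lemma modelCos_add {K : ℝ} (hK : K ≠ 0) (x y : ℝ) :
    modelCos K (x + y) = modelCos K x * modelCos K y - K * modelSin K x * modelSin K y := by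
  have hk := (kappa_pos hK).ne'
  unfold modelCos modelSin
  split_ifs with h
  · have := kappa_sq_of_pos h
    rw [mul_add, Real.cos_add]
    field_simp
    rw [this]; ring
  · have := kappa_sq_of_not_pos h
    rw [mul_add, Real.cosh_add]
    field_simp
    rw [this]; ring

lemma modelCos_sub {K : ℝ} (hK : K ≠ 0) (x y : ℝ) :
    modelCos K (x - y) = modelCos K x * modelCos K y + K * modelSin K x * modelSin K y := by
  rw [sub_eq_add_neg, modelCos_add hK, modelCos_neg, modelSin_neg]; ring

lemma modelCos_sq_add {K : ℝ} (hK : K ≠ 0) (x : ℝ) :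
    modelCos K x ^ 2 + K * modelSin K x ^ 2 = 1 := by
  have := modelCos_sub hK x x
  rw [sub_self, modelCos_zero] at this
  linarith

lemma modelCos_sub_modelCos {K : ℝ} (hK : K ≠ 0) (z w : ℝ) :
    modelCos K z - modelCos K w = K * (2 * modelSin K ((w + z) / 2) * modelSin K ((w - z) / 2)) := by
  have h1 := modelCos_sub hK ((w + z) / 2) ((w - z) / 2)
  have h2 := modelCos_add hK ((w + z) / 2) ((w - z) / 2)
  rw [show (w + z) / 2 - (w - z) / 2 = z by ring] at h1
  rw [show (w + z) / 2 + (w - z) / 2 = w by ring] at h2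
  rw [h1, h2]; ring

lemma hasDerivAt_modelCos {K : ℝ} (hK : K ≠ 0) (t : ℝ) :
    HasDerivAt (modelCos K) (-(K * modelSin K t)) t := by
  have hk := (kappa_pos hK).ne'
  have h0 : HasDerivAt (fun t => kappa K * t) (kappa K) t := by
    simpa using (hasDerivAt_id t).const_mul (kappa K)
  by_cases h : 0 < K
  · have e : modelCos K = fun t => cos (kappa K * t) := by ext t; simp [modelCos, h]
    rw [e]
    convert h0.cos using 1
    have := kappa_sq_of_pos h
    simp only [modelSin, h, if_true]
    field_simp
    rw [this]
  · have e : modelCos K = fun t => cosh (kappa K * t) := by ext t; simp [modelCos, h]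
    rw [e]
    convert h0.cosh using 1
    have := kappa_sq_of_not_pos h
    simp only [modelSin, h, if_false]
    field_simp
    rw [this]; ring

lemma hasDerivAt_modelSin {K : ℝ} (hK : K ≠ 0) (t : ℝ) :
    HasDerivAt (modelSin K) (modelCos K t) t := by
  have hk := (kappa_pos hK).ne'
  have h0 : HasDerivAt (fun t => kappa K * t) (kappa K) t := by
    simpa using (hasDerivAt_id t).const_mul (kappa K)
  by_cases h : 0 < K
  · have e : modelSin K = fun t => sin (kappa K * t) / kappa K := by ext t; simp [modelSin, h]
    rw [e]
    have e' : modelCos K t = cos (kappa K * t) * kappa K / kappa K := by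
      simp [modelCos, h, hk]
    exact e' ▸ h0.sin.div_const (kappa K)
  · have e : modelSin K = fun t => sinh (kappa K * t) / kappa K := by ext t; simp [modelSin, h]
    rw [e]
    have e' : modelCos K t = cosh (kappa K * t) * kappa K / kappa K := by
      simp [modelCos, h, hk]
    exact e' ▸ h0.sinh.div_const (kappa K)

lemma continuous_modelCos {K : ℝ} (hK : K ≠ 0) : Continuous (modelCos K) :=
  continuous_iff_continuousAt.2 fun t => (hasDerivAt_modelCos hK t).continuousAt

lemma continuous_modelSin {K : ℝ} (hK : K ≠ 0) : Continuous (modelSin K) :=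
  continuous_iff_continuousAt.2 fun t => (hasDerivAt_modelSin hK t).continuousAt

lemma modelSin_pos {K t : ℝ} (hK : K ≠ 0) (ht : 0 < t) (htK : 0 < K → kappa K * t < π) :
    0 < modelSin K t := by
  have hk := kappa_pos hK
  unfold modelSin
  split_ifs with h
  · exact div_pos (sin_pos_of_pos_of_lt_pi (by positivity) (htK h)) hk
  · exact div_pos (Real.sinh_pos_iff.2 (by positivity)) hk

lemma modelSin_nonneg {K t : ℝ} (hK : K ≠ 0) (ht : 0 ≤ t) (htK : 0 < K → kappa K * t ≤ π) :
    0 ≤ modelSin K t := by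
  have hk := kappa_pos hK
  unfold modelSin
  split_ifs with h
  · exact div_nonneg (sin_nonneg_of_nonneg_of_le_pi (by positivity) (htK h)) hk.le
  · exact div_nonneg (Real.sinh_nonneg_iff.2 (by positivity)) hk.le

/-- On `[0, R]` the function `modelSin K` is at most linear. -/
lemma exists_modelSin_le {K : ℝ} (hK : K ≠ 0) (R : ℝ) :
    ∃ c > 0, ∀ t ∈ Icc 0 R, modelSin K t ≤ c * t := by
  obtain ⟨c, hc⟩ := (isCompact_Icc (a := (0 : ℝ)) (b := R)).exists_bound_of_continuousOn
    (continuous_modelCos hK).continuousOn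
  refine ⟨max c 1, by positivity, fun t ht => ?_⟩
  have := (convex_Icc (0 : ℝ) R).norm_image_sub_le_of_norm_hasDerivWithin_le
    (f := modelSin K) (C := max c 1) (x := 0) (y := t)
    (fun x _ => (hasDerivAt_modelSin hK x).hasDerivWithinAt)
    (fun x hx => (hc x hx).trans (le_max_left _ _)) ⟨le_rfl, ht.1.trans ht.2⟩ ht
  rw [modelSin_zero, sub_zero, sub_zero, Real.norm_eq_abs, Real.norm_eq_abs, abs_of_nonneg ht.1]
    at this
  exact (le_abs_self _).trans this

/-- For `K > 0` the larger argument `w` may exceed `π / √K`, as the sum of two sides of a triangle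
does in general. -/
lemma modelCos_div_le {K z w : ℝ} (hK : K ≠ 0) (hz : 0 ≤ z) (hzw : z ≤ w)
    (h : 0 < K → kappa K * (z + w) ≤ 2 * π) : modelCos K w / K ≤ modelCos K z / K := by
  have h0 := modelCos_sub_modelCos hK z w
  have hk := kappa_pos hK
  have h1 : 0 ≤ modelSin K ((w + z) / 2) :=
    modelSin_nonneg hK (by linarith) fun h' => by have := h h'; linarith
  have h2 : 0 ≤ modelSin K ((w - z) / 2) :=
    modelSin_nonneg hK (by linarith) fun h' => by have := h h'; nlinarith
  have h3 : modelCos K z / K - modelCos K w / K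
      = 2 * modelSin K ((w + z) / 2) * modelSin K ((w - z) / 2) := by
    rw [← sub_div, h0]; field_simp
  nlinarith [mul_nonneg h1 h2]

lemma modelCos_div_lt {K z w : ℝ} (hK : K ≠ 0) (hz : 0 ≤ z) (hzw : z < w)
    (h : 0 < K → kappa K * w < π) : modelCos K w / K < modelCos K z / K := by
  have h0 := modelCos_sub_modelCos hK z w
  have hk := kappa_pos hK
  have h1 : 0 < modelSin K ((w + z) / 2) :=
    modelSin_pos hK (by linarith) fun h' => by have := h h'; nlinarith
  have h2 : 0 < modelSin K ((w - z) / 2) :=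
    modelSin_pos hK (by linarith) fun h' => by have := h h'; nlinarith
  have h3 : modelCos K z / K - modelCos K w / K
      = 2 * modelSin K ((w + z) / 2) * modelSin K ((w - z) / 2) := by
    rw [← sub_div, h0]; field_simp
  nlinarith [mul_pos h1 h2]

lemma modelAngle_eq_arccos {K : ℝ} (hK : K ≠ 0) (x y z : ℝ) :
    modelAngle K x y z =
      arccos ((modelCos K z - modelCos K x * modelCos K y) / (K * modelSin K x * modelSin K y)) := by
  have hk := (kappa_pos hK).ne'
  unfold modelAngle modelCos modelSin
  split_ifs with h h'
  · have e := kappa_sq_of_pos h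
    congr 2
    field_simp
    rw [e]; field_simp
  · have e := kappa_sq_of_not_pos h
    congr 1
    rw [show K * (sinh (kappa K * x) / kappa K) * (sinh (kappa K * y) / kappa K)
      = -(sinh (kappa K * x) * sinh (kappa K * y)) by
        field_simp
        rw [e]; ring]
    rw [div_neg, ← neg_div, neg_sub]
  · exact absurd (lt_of_le_of_ne (not_lt.1 h) hK) h'

lemma modelAngle_nonneg (K x y z : ℝ) : 0 ≤ modelAngle K x y z := by
  unfold modelAngle; split_ifs <;> exact arccos_nonneg _

lemma modelAngle_le_pi (K x y z : ℝ) : modelAngle K x y z ≤ π := by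
  unfold modelAngle; split_ifs <;> exact arccos_le_pi _

lemma modelAngle_comm (K x y z : ℝ) : modelAngle K x y z = modelAngle K y x z := by
  unfold modelAngle; split_ifs <;> congr 1 <;> ring

/-- `x`, `y`, `z` are the side lengths of a triangle in the `K`-plane; only the sides `x` and `y`,
which enclose an angle, are required to be non-degenerate. -/
structure IsModelTriangle (K x y z : ℝ) : Prop where
  pos_left : 0 < x
  pos_right : 0 < y
  le_add : z ≤ x + y
  left_le : x ≤ y + z
  right_le : y ≤ x + z
  perimeter_lt : 0 < K → kappa K * (x + y + z) < 2 * π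

namespace IsModelTriangle

variable {K x y z : ℝ}

lemma nonneg (h : IsModelTriangle K x y z) : 0 ≤ z := by
  have := h.left_le; have := h.right_le; linarith

lemma symm (h : IsModelTriangle K x y z) : IsModelTriangle K y x z :=
  ⟨h.pos_right, h.pos_left, by have := h.le_add; linarith, h.right_le, h.left_le,
    fun hK => by have := h.perimeter_lt hK; rwa [add_comm y x]⟩

lemma rotate (h : IsModelTriangle K x y z) (hz : 0 < z) : IsModelTriangle K x z y :=
  ⟨h.pos_left, hz, by have := h.right_le; linarith, by have := h.left_le; linarith, h.le_add,
    fun hK => by have := h.perimeter_lt hK; rwa [add_right_comm]⟩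

lemma kappa_left_lt (h : IsModelTriangle K x y z) (hK : 0 < K) : kappa K * x < π := by
  have := h.perimeter_lt hK; have := kappa_pos hK.ne'; have := h.left_le; nlinarith

lemma kappa_third_lt (h : IsModelTriangle K x y z) (hK : 0 < K) : kappa K * z < π := by
  have := h.perimeter_lt hK; have := kappa_pos hK.ne'; have := h.le_add; nlinarith

lemma modelSin_left_pos (hK : K ≠ 0) (h : IsModelTriangle K x y z) : 0 < modelSin K x :=
  modelSin_pos hK h.pos_left h.kappa_left_lt

lemma modelSin_right_pos (hK : K ≠ 0) (h : IsModelTriangle K x y z) : 0 < modelSin K y :=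
  h.symm.modelSin_left_pos hK

/-- The law of cosines in the `K`-plane. -/
lemma law_of_cosines (hK : K ≠ 0) (h : IsModelTriangle K x y z) :
    modelCos K z / K = modelCos K x * modelCos K y / K
      + modelSin K x * modelSin K y * cos (modelAngle K x y z) := by
  have hx := h.modelSin_left_pos hK
  have hy := h.modelSin_right_pos hK
  have hxy := mul_pos hx hy
  have e : (modelCos K z - modelCos K x * modelCos K y) / (K * modelSin K x * modelSin K y)
      = (modelCos K z / K - modelCos K x * modelCos K y / K) / (modelSin K x * modelSin K y) := by
    field_simp
  have hlow : modelCos K (x + y) / K ≤ modelCos K z / K :=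
    modelCos_div_le hK h.nonneg h.le_add fun hK' => by
      have := h.perimeter_lt hK'; rw [add_comm z]; exact this.le
  have hupp : modelCos K z / K ≤ modelCos K (x - y) / K := by
    have habs : modelCos K (x - y) = modelCos K |x - y| := by
      rcases abs_choice (x - y) with h' | h' <;> rw [h']
      rw [modelCos_neg]
    rw [habs]
    refine modelCos_div_le hK (abs_nonneg _)
      (abs_le.2 ⟨by have := h.right_le; linarith, by have := h.left_le; linarith⟩) fun hK' => ?_
    have h1 : |x - y| ≤ x + y :=
      abs_le.2 ⟨by have := h.pos_left; linarith, by have := h.pos_right; linarith⟩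
    have h2 := h.perimeter_lt hK'
    have h3 := kappa_pos hK
    nlinarith
  rw [modelCos_add hK, sub_div] at hlow
  rw [modelCos_sub hK, add_div] at hupp
  have e1 : K * modelSin K x * modelSin K y / K = modelSin K x * modelSin K y := by field_simp
  rw [e1] at hlow hupp
  rw [modelAngle_eq_arccos hK, e, cos_arccos]
  · field_simp; ring
  · rw [le_div_iff₀ hxy]; linarith
  · rw [div_le_iff₀ hxy]; linarith

/-- The law of sines in the `K`-plane. -/
lemma law_of_sines (hK : K ≠ 0) (h : IsModelTriangle K x y z) (hz : 0 < z) :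
    modelSin K y * sin (modelAngle K x y z) = modelSin K z * sin (modelAngle K x z y) := by
  have hx := h.modelSin_left_pos hK
  have hy := h.modelSin_right_pos hK
  have hz' := (h.rotate hz).modelSin_right_pos hK
  have l1 := h.law_of_cosines hK
  have l2 := (h.rotate hz).law_of_cosines hK
  have s1 := sin_nonneg_of_nonneg_of_le_pi (modelAngle_nonneg K x y z) (modelAngle_le_pi K x y z)
  have s2 := sin_nonneg_of_nonneg_of_le_pi (modelAngle_nonneg K x z y) (modelAngle_le_pi K x z y)
  have q1 := sin_sq (modelAngle K x y z)
  have q2 := sin_sq (modelAngle K x z y)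
  have px := modelCos_sq_add hK x
  have py := modelCos_sq_add hK y
  have pz := modelCos_sq_add hK z
  set a := sin (modelAngle K x y z)
  set b := sin (modelAngle K x z y)
  set p := cos (modelAngle K x y z)
  set q := cos (modelAngle K x z y)
  field_simp at l1 l2
  -- Both sides, multiplied by `K * modelSin K x` and squared, give the Gram determinant of the
  -- three vertices.
  have key : (modelSin K y * a) ^ 2 = (modelSin K z * b) ^ 2 := by
    have h1 : (K * modelSin K x) ^ 2 * (modelSin K y * a) ^ 2
        = (K * modelSin K x ^ 2) * (K * modelSin K y ^ 2)
          - (modelCos K z - modelCos K x * modelCos K y) ^ 2 := by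
      rw [l1, mul_pow _ a, q1]; ring
    have h2 : (K * modelSin K x) ^ 2 * (modelSin K z * b) ^ 2
        = (K * modelSin K x ^ 2) * (K * modelSin K z ^ 2)
          - (modelCos K y - modelCos K x * modelCos K z) ^ 2 := by
      rw [l2, mul_pow _ b, q2]; ring
    have e : (K * modelSin K x) ^ 2 * (modelSin K y * a) ^ 2
        = (K * modelSin K x) ^ 2 * (modelSin K z * b) ^ 2 := by
      rw [h1, h2, eq_sub_of_add_eq' px, eq_sub_of_add_eq' py, eq_sub_of_add_eq' pz]; ring
    exact mul_left_cancel₀ (by positivity) e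
  exact (pow_left_inj₀ (by positivity) (by positivity) two_ne_zero).1 key

/-- The projection formula: it expresses the derivative of the side `z` with respect to `x`, the
angle enclosed by `x` and `y` being fixed. -/
lemma projection (hK : K ≠ 0) (h : IsModelTriangle K x y z) (hz : 0 < z) :
    modelSin K z * cos (modelAngle K x z y) =
      modelCos K y * modelSin K x - modelSin K y * modelCos K x * cos (modelAngle K x y z) := by
  have hx := h.modelSin_left_pos hK
  have l1 := h.law_of_cosines hK
  have l2 := (h.rotate hz).law_of_cosines hK
  have px := modelCos_sq_add hK x
  field_simp at l1 l2
  have e : (K * modelSin K x) * (modelSin K z * cos (modelAngle K x z y)) = (K * modelSin K x) *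
      (modelCos K y * modelSin K x - modelSin K y * modelCos K x * cos (modelAngle K x y z)) := by
    linear_combination (-1) * l2 - modelCos K x * l1 - modelCos K y * px
  exact mul_left_cancel₀ (mul_ne_zero hK hx.ne') e

end IsModelTriangle

/-! ### Shortests and their parametrization by arc length -/

/-- `l` parametrizes a shortest by arc length on `[0, a]`. -/
def IsUnitSpeed {M : Type*} [MetricSpace M] (l : ℝ → M) (a : ℝ) : Prop :=
  ∀ s ∈ Icc 0 a, ∀ t ∈ Icc 0 a, dist (l s) (l t) = |s - t|

lemma image_reverse_Icc {M : Type*} (l : ℝ → M) (s : ℝ) :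
    (fun t => l (s - t)) '' Icc 0 s = l '' Icc 0 s := by
  rw [show (fun t => l (s - t)) = l ∘ fun t => s - t from rfl, image_comp]
  simp

section Arcs

variable {M : Type*} [MetricSpace M]

/-- Along a curve whose length is the distance of its ends the triangle inequality is sharp, so the
distance from the initial point is an arc length parameter. -/
lemma IsShortest.exists_isUnitSpeed {L : Set M} {P Q : M} (h : IsShortest L P Q) :
    ∃ l : ℝ → M, IsUnitSpeed l (dist P Q) ∧ l 0 = P ∧ l (dist P Q) = Q ∧
      l '' Icc 0 (dist P Q) = L := by
  obtain ⟨γ, hγ, rfl⟩ := h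
  have key : ∀ s t : unitInterval, s ≤ t →
      dist P (γ s) + dist (γ s) (γ t) + dist (γ t) Q ≤ dist P Q := by
    intro s t hst
    have h1 : edist P (γ s) ≤ eVariationOn γ (Iic s) := by
      have := eVariationOn.edist_le (f := γ) (s := Iic s) (x := 0) (y := s) (by simp) (by simp)
      rwa [γ.source] at this
    have h2 : edist (γ s) (γ t) ≤ eVariationOn γ (Icc s t) :=
      eVariationOn.edist_le _ ⟨le_rfl, hst⟩ ⟨hst, le_rfl⟩
    have h3 : edist (γ t) Q ≤ eVariationOn γ (Ici t) := by
      have := eVariationOn.edist_le (f := γ) (s := Ici t) (x := t) (y := 1) (by simp)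
        (mem_Ici.2 (unitInterval.le_one' (t := t)))
      rwa [γ.target] at this
    have h4 : eVariationOn γ (Iic s) + eVariationOn γ (Icc s t) ≤ eVariationOn γ (Iic s ∪ Icc s t) :=
      eVariationOn.add_le_union _ fun x hx y hy => le_trans hx hy.1
    have h5 : eVariationOn γ (Iic s ∪ Icc s t) + eVariationOn γ (Ici t)
        ≤ eVariationOn γ ((Iic s ∪ Icc s t) ∪ Ici t) :=
      eVariationOn.add_le_union _ fun x hx y hy =>
        hx.elim (fun hx => (le_trans hx hst).trans hy) fun hx => hx.2.trans hy
    have h6 : edist P (γ s) + edist (γ s) (γ t) + edist (γ t) Q ≤ edist P Q := by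
      rw [← hγ]
      exact (add_le_add (add_le_add h1 h2) h3).trans
        ((add_le_add_left h4 _).trans (h5.trans (eVariationOn.mono _ (subset_univ _))))
    simp only [edist_dist] at h6
    rw [← ENNReal.ofReal_add dist_nonneg dist_nonneg,
      ← ENNReal.ofReal_add (by positivity) dist_nonneg,
      ENNReal.ofReal_le_ofReal_iff dist_nonneg] at h6
    exact h6
  have hdist : ∀ s t : unitInterval, dist (γ s) (γ t) = |dist P (γ s) - dist P (γ t)| := by
    have aux : ∀ s t : unitInterval, s ≤ t → dist (γ s) (γ t) = |dist P (γ s) - dist P (γ t)| := by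
      intro s t hst
      have h1 := key s t hst
      have h2 := dist_triangle P (γ t) Q
      have h3 := dist_triangle P (γ s) (γ t)
      have h4 : (0 : ℝ) ≤ dist (γ s) (γ t) := dist_nonneg
      rw [abs_of_nonpos] <;> linarith
    intro s t
    rcases le_total s t with h | h
    · exact aux s t h
    · rw [dist_comm, aux t s h, abs_sub_comm]
  have hsurj : ∀ r : ℝ, ∃ u : unitInterval, r ∈ Icc 0 (dist P Q) → dist P (γ u) = r := by
    intro r
    by_cases hr : r ∈ Icc 0 (dist P Q)
    · have hc : Continuous fun u : unitInterval => dist P (γ u) := by fun_prop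
      obtain ⟨u, hu⟩ := mem_range_of_exists_le_of_exists_ge hc (c := r)
        ⟨0, by simpa using hr.1⟩ ⟨1, by simpa using hr.2⟩
      exact ⟨u, fun _ => hu⟩
    · exact ⟨0, fun h => absurd h hr⟩
  choose u hu using hsurj
  have h0 : (0 : ℝ) ∈ Icc 0 (dist P Q) := ⟨le_rfl, dist_nonneg⟩
  have h1 : dist P Q ∈ Icc 0 (dist P Q) := ⟨dist_nonneg, le_rfl⟩
  have hle : ∀ v, dist P (γ v) ∈ Icc 0 (dist P Q) := fun v => ⟨dist_nonneg, by
    have := key v v le_rfl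
    have h' : (0 : ℝ) ≤ dist (γ v) Q := dist_nonneg
    rw [dist_self] at this; linarith⟩
  refine ⟨fun r => γ (u r), fun s hs t ht => ?_, ?_, ?_, ?_⟩
  · rw [hdist, hu s hs, hu t ht]
  · exact (dist_eq_zero.1 (hu 0 h0)).symm
  · have h2 := hdist (u (dist P Q)) 1
    rw [hu _ h1, γ.target, sub_self, abs_zero] at h2
    exact dist_eq_zero.1 h2
  · ext X
    constructor
    · rintro ⟨r, -, rfl⟩
      exact ⟨_, rfl⟩
    · rintro ⟨v, rfl⟩
      refine ⟨_, hle v, ?_⟩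
      have h2 := hdist (u (dist P (γ v))) v
      rw [hu _ (hle v), sub_self, abs_zero] at h2
      exact dist_eq_zero.1 h2

namespace IsUnitSpeed

variable {l : ℝ → M} {a : ℝ}

lemma mono (hl : IsUnitSpeed l a) {s : ℝ} (hs : s ≤ a) : IsUnitSpeed l s :=
  fun x hx y hy => hl x ⟨hx.1, hx.2.trans hs⟩ y ⟨hy.1, hy.2.trans hs⟩

lemma dist_zero_left (hl : IsUnitSpeed l a) {s : ℝ} (hs : s ∈ Icc 0 a) : dist (l 0) (l s) = s := by
  rw [hl 0 ⟨le_rfl, hs.1.trans hs.2⟩ s hs, zero_sub, abs_neg, abs_of_nonneg hs.1]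

lemma reverse (hl : IsUnitSpeed l a) {s : ℝ} (hs : s ≤ a) : IsUnitSpeed (fun t => l (s - t)) s := by
  intro x hx y hy
  rw [hl (s - x) ⟨by linarith [hx.2], by linarith [hx.1]⟩ (s - y)
    ⟨by linarith [hy.2], by linarith [hy.1]⟩, abs_sub_comm]
  congr 1; ring

lemma shift (hl : IsUnitSpeed l a) {s : ℝ} (hs : 0 ≤ s) :
    IsUnitSpeed (fun t => l (s + t)) (a - s) := by
  intro x hx y hy
  rw [hl (s + x) ⟨by linarith [hx.1], by linarith [hx.2]⟩ (s + y)
    ⟨by linarith [hy.1], by linarith [hy.2]⟩]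
  congr 1; ring

lemma isShortest (hl : IsUnitSpeed l a) (ha : 0 ≤ a) :
    IsShortest (l '' Icc 0 a) (l 0) (l a) := by
  have hmem : ∀ t : unitInterval, a * t ∈ Icc 0 a := fun t =>
    ⟨mul_nonneg ha t.2.1, mul_le_of_le_one_right ha t.2.2⟩
  have hd : ∀ s t : unitInterval, dist (l (a * s)) (l (a * t)) = dist (a * s : ℝ) (a * t) :=
    fun s t => hl _ (hmem s) _ (hmem t)
  have hc : Continuous fun t : unitInterval => l (a * t) := by
    refine (LipschitzWith.of_dist_le_mul (K := a.toNNReal) fun s t => ?_).continuous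
    rw [hd, Real.dist_eq, ← mul_sub, abs_mul, abs_of_nonneg ha, Real.coe_toNNReal a ha,
      Subtype.dist_eq, Real.dist_eq]
  let γ : Path (l 0) (l a) := ⟨⟨fun t => l (a * t), hc⟩, by simp, by simp⟩
  refine ⟨γ, ?_, ?_⟩
  · refine le_antisymm ?_ ?_
    · have h1 : eVariationOn γ univ = eVariationOn (fun t : unitInterval => a * (t : ℝ)) univ := by
        have hγ : ∀ s t, edist (γ s) (γ t) = edist (a * (s : ℝ)) (a * (t : ℝ)) := fun s t => by
          rw [edist_dist, edist_dist]
          exact congrArg _ (hd s t)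
        simp only [eVariationOn, hγ]
      have h2 : MonotoneOn (fun t : unitInterval => a * (t : ℝ)) univ := fun s _ t _ hst =>
        mul_le_mul_of_nonneg_left hst ha
      have h3 := h2.eVariationOn_eq (a := 0) (b := 1) (mem_univ _) (mem_univ _)
      have h4 : (univ ∩ Icc 0 1 : Set unitInterval) = univ := by
        exact eq_univ_of_forall fun t =>
          ⟨trivial, unitInterval.nonneg', unitInterval.le_one'⟩
      rw [h4] at h3
      rw [h1, edist_dist, hl.dist_zero_left ⟨ha, le_rfl⟩]
      simpa using h3.le
    · have := eVariationOn.edist_le (f := γ) (s := univ) (x := 0) (y := 1) (mem_univ _) (mem_univ _)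
      rwa [γ.source, γ.target] at this
  · ext X
    constructor
    · rintro ⟨t, ht, rfl⟩
      rcases ha.eq_or_lt with rfl | ha'
      · refine ⟨0, ?_⟩
        rw [γ.source, le_antisymm ht.2 ht.1]
      · refine ⟨⟨t / a, div_nonneg ht.1 ha, (div_le_one ha').2 ht.2⟩, ?_⟩
        change l (a * (t / a)) = l t
        rw [mul_div_cancel₀ _ ha'.ne']
    · rintro ⟨t, rfl⟩
      exact ⟨a * t, hmem t, rfl⟩

lemma isShortest_symm (hl : IsUnitSpeed l a) (ha : 0 ≤ a) :
    IsShortest (l '' Icc 0 a) (l a) (l 0) := by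
  have := (hl.reverse le_rfl).isShortest ha
  rw [image_reverse_Icc] at this
  simpa using this

/-- A shortest is parametrized by arc length, hence leaves its initial point. -/
lemma tendsto_nhdsWithin (hl : IsUnitSpeed l a) (ha : 0 < a) :
    Tendsto l (𝓝[>] 0) (𝓝[l '' Icc 0 a \ {l 0}] (l 0)) := by
  have hev : ∀ᶠ t in 𝓝[>] (0 : ℝ), t ∈ Ioc 0 a := Ioc_mem_nhdsGT ha
  refine tendsto_nhdsWithin_iff.2 ⟨?_, ?_⟩
  · refine tendsto_iff_dist_tendsto_zero.2 ?_
    have : Tendsto (fun t : ℝ => t) (𝓝[>] 0) (𝓝 0) := nhdsWithin_le_nhds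
    refine this.congr' ?_
    filter_upwards [hev] with t ht
    rw [dist_comm, hl.dist_zero_left ⟨ht.1.le, ht.2⟩]
  · filter_upwards [hev] with t ht
    refine ⟨mem_image_of_mem _ ⟨ht.1.le, ht.2⟩, fun h => ?_⟩
    have := hl.dist_zero_left ⟨ht.1.le, ht.2⟩
    rw [mem_singleton_iff.1 h, dist_self] at this
    exact ht.1.ne this

lemma nhdsWithin_image_eq (hl : IsUnitSpeed l a) {s : ℝ} (hs : 0 < s) (hsa : s ≤ a) :
    𝓝[l '' Icc 0 s \ {l 0}] (l 0) = 𝓝[l '' Icc 0 a \ {l 0}] (l 0) := by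
  rw [nhdsWithin_eq_iff_eventuallyEq]
  filter_upwards [Metric.ball_mem_nhds (l 0) hs] with X hX
  refine propext ⟨fun h => ⟨image_mono (Icc_subset_Icc_right hsa) h.1, h.2⟩, fun h => ⟨?_, h.2⟩⟩
  obtain ⟨⟨t, ht, rfl⟩, -⟩ := h
  rw [Metric.mem_ball, dist_comm, hl.dist_zero_left ht] at hX
  exact mem_image_of_mem _ ⟨ht.1, hX.le⟩

end IsUnitSpeed

end Arcs

/-! ### Upper angles and the first variation inequality -/

lemma eventually_pos_of_hasDerivAt {f : ℝ → ℝ} {f' : ℝ} (hf : HasDerivAt f f' 0) (h0 : f 0 = 0)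
    (hf' : 0 < f') : ∀ᶠ x in 𝓝[>] 0, 0 < f x := by
  filter_upwards [hf.tendsto_slope_zero_right.eventually (lt_mem_nhds hf'), self_mem_nhdsWithin]
    with t ht ht0
  rw [zero_add, h0, sub_zero, smul_eq_mul] at ht
  exact (pos_iff_pos_of_mul_pos ht).1 (inv_pos.2 ht0)

/-- A triangle with fixed side `y` and a small side `x` enclosing an angle of cosine `k'` has its
third side shorter than `y - x * k`, if `k < k'`. -/
lemma eventually_modelCos_sub_lt {K y k k' : ℝ} (hK : K ≠ 0) (hy : 0 < modelSin K y) (hk : k < k') :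
    ∀ᶠ x in 𝓝[>] 0, modelCos K (y - x * k) / K
      < modelCos K x * modelCos K y / K + modelSin K x * modelSin K y * k' := by
  have hin : HasDerivAt (fun x : ℝ => y - x * k) (-k) 0 := by
    simpa using ((hasDerivAt_id (0 : ℝ)).mul_const k).const_sub y
  have h1 : HasDerivAt (fun x : ℝ => modelCos K (y - x * k)) (-(K * modelSin K y) * (-k)) 0 := by
    have h := hasDerivAt_modelCos hK (y - 0 * k)
    have := h.comp (0 : ℝ) hin
    simpa [Function.comp_def] using this
  have h2 := (hasDerivAt_modelCos hK 0).mul_const (modelCos K y)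
  have h3 := ((hasDerivAt_modelSin hK 0).mul_const (modelSin K y)).mul_const k'
  have h4 := ((h2.div_const K).add h3).sub (h1.div_const K)
  have := eventually_pos_of_hasDerivAt h4 (by simp [modelCos_zero, modelSin_zero]) (by
    rw [modelSin_zero, modelCos_zero]
    have : (-(K * modelSin K y) * -k) / K = modelSin K y * k := by field_simp
    rw [this]
    have := mul_lt_mul_of_pos_left hk hy
    simp; linarith)
  filter_upwards [this] with x hx
  simp only [Pi.sub_apply, Pi.add_apply] at hx
  linarith

section UpperAngle

variable {M : Type*} [MetricSpace M] {K : ℝ}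

lemma comparisonAngle_comm (K : ℝ) (X O Y : M) :
    comparisonAngle K X O Y = comparisonAngle K Y O X := by
  rw [comparisonAngle, comparisonAngle, modelAngle_comm, dist_comm X Y]

lemma upperAngle_comm (K : ℝ) (O : M) (L N : Set M) :
    upperAngle K O L N = upperAngle K O N L := by
  rw [upperAngle, upperAngle, Filter.prod_comm, Filter.limsup, Filter.limsup, Filter.map_map]
  congr 2
  ext p
  exact comparisonAngle_comm K _ _ _

lemma isBoundedUnder_comparisonAngle (K : ℝ) (O : M) (f : Filter (M × M)) :
    f.IsBoundedUnder (· ≤ ·) fun p : M × M => comparisonAngle K p.1 O p.2 :=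
  isBoundedUnder_of ⟨π, fun _ => modelAngle_le_pi _ _ _ _⟩

/-- The shortests determine a non-trivial filter, so that the upper limit in the definition of the
upper angle is taken over a nonempty family. -/
lemma IsUnitSpeed.prod_neBot {l n : ℝ → M} {a b : ℝ} (hl : IsUnitSpeed l a) (ha : 0 < a)
    (hn : IsUnitSpeed n b) (hb : 0 < b) :
    (𝓝[l '' Icc 0 a \ {l 0}] (l 0) ×ˢ 𝓝[n '' Icc 0 b \ {n 0}] (n 0)).NeBot :=
  have := (hl.tendsto_nhdsWithin ha).neBot
  have := (hn.tendsto_nhdsWithin hb).neBot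
  inferInstance

lemma IsUnitSpeed.upperAngle_mem_Icc (K : ℝ) {l n : ℝ → M} {a b : ℝ} (hl : IsUnitSpeed l a)
    (ha : 0 < a) (hn : IsUnitSpeed n b) (hb : 0 < b) (h0 : n 0 = l 0) :
    upperAngle K (l 0) (l '' Icc 0 a) (n '' Icc 0 b) ∈ Icc 0 π := by
  have hne := hl.prod_neBot ha hn hb
  rw [h0] at hne
  refine ⟨le_limsup_of_le (isBoundedUnder_comparisonAngle K _ _) fun b hb => ?_,
    limsup_le_of_le ?_ (Eventually.of_forall fun _ => modelAngle_le_pi _ _ _ _)⟩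
  · obtain ⟨p, hp⟩ := hb.exists
    exact (modelAngle_nonneg _ _ _ _).trans hp
  · exact Filter.IsBoundedUnder.isCoboundedUnder_le
      (isBoundedUnder_of ⟨0, fun _ => modelAngle_nonneg _ _ _ _⟩)

/-- Upper angles depend only on the initial pieces of the shortests. -/
lemma IsUnitSpeed.upperAngle_eq (K : ℝ) {l n : ℝ → M} {a b s t : ℝ} (hl : IsUnitSpeed l a)
    (hs : 0 < s) (hsa : s ≤ a) (hn : IsUnitSpeed n b) (ht : 0 < t) (htb : t ≤ b) (h0 : n 0 = l 0) :
    upperAngle K (l 0) (l '' Icc 0 s) (n '' Icc 0 t)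
      = upperAngle K (l 0) (l '' Icc 0 a) (n '' Icc 0 b) := by
  have h2 := hn.nhdsWithin_image_eq ht htb
  rw [h0] at h2
  rw [upperAngle, upperAngle, hl.nhdsWithin_image_eq hs hsa, h2]

lemma sub_le_cos_of_lt_add {θ φ ε : ℝ} (hθ : 0 ≤ θ) (hφ : φ ∈ Icc 0 π) (hε : 0 ≤ ε)
    (h : θ < φ + ε) : cos φ - ε ≤ cos θ := by
  rcases le_total θ φ with h' | h'
  · have := cos_le_cos_of_nonneg_of_le_pi hθ hφ.2 h'
    linarith
  · have := Real.abs_cos_sub_cos_le φ θ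
    have h1 := (le_abs_self _).trans this
    rw [abs_sub_comm, abs_of_nonneg (by linarith)] at h1
    linarith

end UpperAngle

section ReDomain

variable {M : Type*} [MetricSpace M] {K : ℝ}

lemma IsReDomain.exists_isUnitSpeed (hM : IsReDomain K M) (P Q : M) :
    ∃ l : ℝ → M, IsUnitSpeed l (dist P Q) ∧ l 0 = P ∧ l (dist P Q) = Q :=
  let ⟨_, hL⟩ := hM.exists_shortest P Q
  let ⟨l, h1, h2, h3, _⟩ := hL.exists_isUnitSpeed
  ⟨l, h1, h2, h3⟩

lemma IsReDomain.perimeter_lt_of_ne (hM : IsReDomain K M) (hK : 0 < K) {P Q R : M} (hPQ : P ≠ Q)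
    (hQR : Q ≠ R) (hRP : R ≠ P) : kappa K * (dist P Q + dist Q R + dist R P) < 2 * π := by
  obtain ⟨L₁, h₁⟩ := hM.exists_shortest P Q
  obtain ⟨L₂, h₂⟩ := hM.exists_shortest Q R
  obtain ⟨L₃, h₃⟩ := hM.exists_shortest R P
  have h := hM.perimeter_lt hK ⟨P, Q, R, L₁, L₂, L₃, hPQ, hQR, hRP, h₁, h₂, h₃⟩
  have hk : √K = kappa K := by rw [kappa, abs_of_pos hK]
  rw [hk, lt_div_iff₀ (kappa_pos hK.ne')] at h
  rw [mul_comm]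
  exact h

/-- Apply the bound on perimeters to the ends and the midpoint of a shortest. -/
lemma IsReDomain.kappa_mul_dist_lt (hM : IsReDomain K M) (hK : 0 < K) (P Q : M) :
    kappa K * dist P Q < π := by
  rcases eq_or_ne P Q with rfl | hPQ
  · simpa using pi_pos
  obtain ⟨l, hl, h0, h1⟩ := hM.exists_isUnitSpeed P Q
  have hd := dist_pos.2 hPQ
  have m0 : (0 : ℝ) ∈ Icc 0 (dist P Q) := ⟨le_rfl, hd.le⟩
  have m1 : dist P Q ∈ Icc 0 (dist P Q) := ⟨hd.le, le_rfl⟩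
  have m2 : dist P Q / 2 ∈ Icc 0 (dist P Q) := ⟨by linarith, by linarith⟩
  have e1 : dist P (l (dist P Q / 2)) = dist P Q / 2 := by
    have := hl.dist_zero_left m2
    rwa [h0] at this
  have e2 : dist (l (dist P Q / 2)) Q = dist P Q / 2 := by
    have := hl _ m2 _ m1
    rw [h1] at this
    rw [this, abs_of_nonpos] <;> linarith
  have h := hM.perimeter_lt_of_ne hK (P := P) (Q := l (dist P Q / 2)) (R := Q)
    (dist_pos.1 (by rw [e1]; linarith)) (dist_pos.1 (by rw [e2]; linarith)) hPQ.symm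
  rw [e1, e2, dist_comm Q P] at h
  linarith

lemma IsReDomain.isModelTriangle (hM : IsReDomain K M) {X O Y : M} (hX : O ≠ X) (hY : O ≠ Y) :
    IsModelTriangle K (dist O X) (dist O Y) (dist X Y) where
  pos_left := dist_pos.2 hX
  pos_right := dist_pos.2 hY
  le_add := dist_triangle_left X Y O
  left_le := by have := dist_triangle_right O X Y; linarith
  right_le := by have := dist_triangle O X Y; linarith
  perimeter_lt hK := by
    rcases eq_or_ne X Y with rfl | hXY
    · have := hM.kappa_mul_dist_lt hK O X
      rw [dist_self]; linarith
    · have := hM.perimeter_lt_of_ne hK hX hXY hY.symm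
      rw [dist_comm Y O] at this
      linarith

/-- The first variation inequality: moving from `l 0` along a shortest that makes the upper angle
`φ` with a shortest from `l 0` to `n b`, one approaches `n b` at rate at least `cos φ`. -/
lemma IsReDomain.first_variation (hM : IsReDomain K M) (hK : K ≠ 0) {l n : ℝ → M} {a b : ℝ}
    (hl : IsUnitSpeed l a) (ha : 0 < a) (hn : IsUnitSpeed n b) (hb : 0 < b) (h0 : n 0 = l 0)
    {ε : ℝ} (hε : 0 < ε) :
    ∀ᶠ h in 𝓝[>] 0, dist (l h) (n b)
      ≤ b - h * (cos (upperAngle K (l 0) (l '' Icc 0 a) (n '' Icc 0 b)) - ε) := by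
  set φ := upperAngle K (l 0) (l '' Icc 0 a) (n '' Icc 0 b) with hφ
  have hφm : φ ∈ Icc 0 π := hl.upperAngle_mem_Icc K ha hn hb h0
  have hφε : upperAngle K (l 0) (l '' Icc 0 a) (n '' Icc 0 b) < φ + ε / 2 :=
    lt_add_of_pos_right φ (half_pos hε)
  have hev := eventually_lt_of_limsup_lt hφε (isBoundedUnder_comparisonAngle K (l 0) _)
  have tn := hn.tendsto_nhdsWithin hb
  rw [h0] at tn
  have ht := ((hl.tendsto_nhdsWithin ha).comp (tendsto_snd (f := 𝓝[>] (0 : ℝ)))).prodMk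
    (tn.comp (tendsto_fst (g := 𝓝[>] (0 : ℝ))))
  -- Fix a point `n y` of the second shortest close to its origin: it suffices to estimate the
  -- distance to this point.
  obtain ⟨y, hyc, hy⟩ := ((ht.eventually hev).curry.and (Ioc_mem_nhdsGT hb)).exists
  have hdy : dist (l 0) (n y) = y := by rw [← h0]; exact hn.dist_zero_left ⟨hy.1.le, hy.2⟩
  have hdyb : dist (n y) (n b) = b - y := by
    rw [hn y ⟨hy.1.le, hy.2⟩ b ⟨hb.le, le_rfl⟩, abs_of_nonpos] <;> linarith [hy.2]
  have hne : l 0 ≠ n y := dist_pos.1 (by rw [hdy]; exact hy.1)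
  have hsy : 0 < modelSin K y := modelSin_pos hK hy.1 fun h => by
    rw [← hdy]; exact hM.kappa_mul_dist_lt h _ _
  have hcont : Tendsto (fun x : ℝ => y - x * (cos φ - ε)) (𝓝[>] 0) (𝓝 y) := by
    have : Continuous fun x : ℝ => y - x * (cos φ - ε) := by fun_prop
    have := this.tendsto 0
    rw [zero_mul, sub_zero] at this
    exact this.mono_left nhdsWithin_le_nhds
  filter_upwards [hyc, Ioc_mem_nhdsGT ha, hcont.eventually (lt_mem_nhds hy.1),
    eventually_modelCos_sub_lt hK hsy (show cos φ - ε < cos φ - ε / 2 by linarith)]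
    with x hx hxa hpos hlt
  have hdx : dist (l 0) (l x) = x := hl.dist_zero_left ⟨hxa.1.le, hxa.2⟩
  have htri : IsModelTriangle K x y (dist (l x) (n y)) := by
    have := hM.isModelTriangle (X := l x) (O := l 0) (Y := n y)
      (dist_pos.1 (by rw [hdx]; exact hxa.1)) hne
    rwa [hdx, hdy] at this
  have hlaw := htri.law_of_cosines hK
  have hang : modelAngle K x y (dist (l x) (n y)) < φ + ε / 2 := by
    simpa [comparisonAngle, hdx, hdy] using hx
  have hcos := sub_le_cos_of_lt_add (modelAngle_nonneg _ _ _ _) hφm (by linarith) hang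
  have hmul := mul_le_mul_of_nonneg_left hcos
    (mul_pos (htri.modelSin_left_pos hK) hsy).le
  have hle : dist (l x) (n y) ≤ y - x * (cos φ - ε) := by
    by_contra! hcon
    have := modelCos_div_lt hK hpos.le hcon htri.kappa_third_lt
    linarith
  linarith [dist_triangle (l x) (n y) (n b)]

end ReDomain

/-! ### Upper angles are at most the comparison angles -/

lemma sub_le_two_mul_of_cos_sub_cos_le {ξ ξ' c : ℝ} (hξ : ξ ∈ Icc 0 π) (hξ' : ξ' ∈ Icc 0 π)
    (hc : 0 ≤ c) (h : cos ξ - cos ξ' ≤ c * sin ξ') : ξ' - ξ ≤ 2 * c := by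
  by_contra! hcon
  obtain ⟨m, hm⟩ : ∃ m, m = (ξ' + ξ) / 2 := ⟨_, rfl⟩
  obtain ⟨w, hw⟩ : ∃ w, w = (ξ' - ξ) / 2 := ⟨_, rfl⟩
  have e1 : ξ' = m + w := by rw [hm, hw]; ring
  have e2 : ξ = m - w := by rw [hm, hw]; ring
  have hw0 : 0 < w := by rw [hw]; linarith
  have hw1 : w ≤ π / 2 := by rw [hw]; linarith [hξ.1, hξ'.2]
  have hm0 : 0 < m := by linarith [hξ.1]
  have hm1 : m < π := by linarith [hξ'.2]
  have hsm := sin_pos_of_pos_of_lt_pi hm0 hm1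
  have hsξ := sin_nonneg_of_nonneg_of_le_pi hξ.1 hξ.2
  rw [e1, e2, cos_sub, cos_add, sin_add] at h
  rw [e2, sin_sub] at hsξ
  have h1 : sin m * sin w ≤ sin m * (c * cos w) := by nlinarith
  have h2 := le_of_mul_le_mul_left h1 hsm
  have hsw := sin_pos_of_pos_of_lt_pi hw0 (by linarith [pi_pos])
  have hcw : 0 < cos w := by
    refine (cos_nonneg_of_neg_pi_div_two_le_of_le (by linarith [pi_pos]) hw1).lt_of_ne fun h0 => ?_
    rw [← h0] at h2; linarith
  have hw2 : w < π / 2 := hw1.lt_of_ne fun h0 => by rw [h0, cos_pi_div_two] at hcw; exact hcw.false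
  have h3 := lt_tan hw0 hw2
  rw [tan_eq_sin_div_cos, lt_div_iff₀ hcw] at h3
  have := lt_of_mul_lt_mul_right (h3.trans_le h2) hcw.le
  linarith

lemma cos_le_of_sub_le {γ γ' d : ℝ} (hγ : γ ∈ Icc 0 π) (hγ' : γ' ∈ Icc 0 π) (hd : 0 ≤ d)
    (h : γ - d ≤ γ') : cos γ' ≤ cos γ + d * sin γ + d ^ 2 := by
  have hs := sin_nonneg_of_nonneg_of_le_pi hγ.1 hγ.2
  rcases le_total γ γ' with h' | h'
  · have := cos_le_cos_of_nonneg_of_le_pi hγ.1 hγ'.2 h'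
    nlinarith [mul_nonneg hd hs]
  · obtain ⟨e, rfl⟩ : ∃ e, γ' = γ - e := ⟨γ - γ', by ring⟩
    have he : 0 ≤ e := by linarith
    have hed : e ≤ d := by linarith
    have h1 := Real.one_sub_sq_div_two_le_cos (x := e)
    have h2 := sin_le he
    rw [cos_sub]
    have h3 : sin γ * sin e ≤ d * sin γ := by
      rw [mul_comm d]; exact mul_le_mul_of_nonneg_left (h2.trans hed) hs
    have h4 : cos γ * cos e - cos γ ≤ 1 - cos e := by nlinarith [neg_one_le_cos γ, cos_le_one e]
    nlinarith

lemma IsModelTriangle.eq_zero_of_sub {K x y : ℝ} (hK : K ≠ 0) (h : IsModelTriangle K x y (y - x)) :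
    modelAngle K x y (y - x) = 0 := by
  have hl := h.law_of_cosines hK
  have hp := mul_pos (h.modelSin_left_pos hK) (h.modelSin_right_pos hK)
  rw [modelCos_sub hK] at hl
  have h1 : modelSin K x * modelSin K y * 1
      = modelSin K x * modelSin K y * cos (modelAngle K x y (y - x)) := by
    have : (modelCos K y * modelCos K x + K * modelSin K y * modelSin K x) / K
        = modelCos K x * modelCos K y / K + modelSin K x * modelSin K y := by field_simp
    linarith
  have h2 := mul_left_cancel₀ hp.ne' h1
  exact injOn_cos ⟨modelAngle_nonneg _ _ _ _, modelAngle_le_pi _ _ _ _⟩ ⟨le_rfl, pi_pos.le⟩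
    (by rw [cos_zero, ← h2])

/-- In a triangle of the `K`-plane with sides `s`, `t`, `z`, shorten `s` by a small `r > 0` and
decrease the angle enclosed by `s` and `t` by `c * log (s / (s - r))`, that is, at the rate `c / s`.
If `k` exceeds the cosine of the angle between `s` and `z` by the amount in `hk`, then the third
side remains longer than `z - r * k`. -/
lemma IsModelTriangle.eventually_pos {K s t z k c : ℝ} (hK : K ≠ 0) (h : IsModelTriangle K s t z)
    (hz : 0 < z)
    (hk : c * (modelSin K s / s) * sin (modelAngle K s z t) < k - cos (modelAngle K s z t)) :
    ∀ᶠ r in 𝓝[>] 0, modelCos K (s - r) * modelCos K t / K + modelSin K (s - r) * modelSin K t *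
        (cos (modelAngle K s t z) + c * (log s - log (s - r)) * sin (modelAngle K s t z)
          + (c * (log s - log (s - r))) ^ 2) < modelCos K (z - r * k) / K := by
  have hs := h.pos_left
  have hin1 : HasDerivAt (fun r : ℝ => z - r * k) (-k) 0 := by
    simpa using ((hasDerivAt_id (0 : ℝ)).mul_const k).const_sub z
  have hin2 : HasDerivAt (fun r : ℝ => s - r) (-1) 0 := by
    simpa using (hasDerivAt_id (0 : ℝ)).const_sub s
  have h1 : HasDerivAt (fun r : ℝ => modelCos K (z - r * k)) (-(K * modelSin K z) * (-k)) 0 := by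
    simpa [Function.comp_def] using (hasDerivAt_modelCos hK (z - 0 * k)).comp (0 : ℝ) hin1
  have h2 : HasDerivAt (fun r : ℝ => modelCos K (s - r)) (-(K * modelSin K s) * (-1)) 0 := by
    simpa [Function.comp_def] using (hasDerivAt_modelCos hK (s - 0)).comp (0 : ℝ) hin2
  have h3 : HasDerivAt (fun r : ℝ => modelSin K (s - r)) (modelCos K s * (-1)) 0 := by
    simpa [Function.comp_def] using (hasDerivAt_modelSin hK (s - 0)).comp (0 : ℝ) hin2
  have h4 : HasDerivAt (fun r : ℝ => c * (log s - log (s - r))) (c * (1 / s)) 0 := by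
    have := ((hin2.log (by simpa using hs.ne')).const_sub (log s)).const_mul c
    rwa [sub_zero, neg_div, neg_neg] at this
  set γ := modelAngle K s t z with hγ
  have h5 := (h1.div_const K).sub (((h2.mul_const (modelCos K t)).div_const K).add
    ((h3.mul_const (modelSin K t)).mul (((h4.mul_const (sin γ)).const_add (cos γ)).add (h4.pow 2))))
  have hlaw := h.law_of_cosines hK
  have hsz := (h.rotate hz).modelSin_right_pos hK
  have := eventually_pos_of_hasDerivAt h5 (by simp [← hγ, hlaw]) (by
    have e1 := h.law_of_sines hK hz
    have e2 := h.projection hK hz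
    rw [← hγ] at e1 e2
    have := mul_lt_mul_of_pos_left hk hsz
    simp only [sub_zero, sub_self, mul_zero, zero_mul, add_zero, Pi.pow_apply, Pi.add_apply]
    have f1 : -(K * modelSin K z) * -k / K = modelSin K z * k := by field_simp
    have f2 : -(K * modelSin K s) * -1 * modelCos K t / K = modelSin K s * modelCos K t := by
      field_simp
    rw [f1, f2]
    have f3 : modelSin K z * (c * (modelSin K s / s) * sin (modelAngle K s z t))
        = modelSin K s * modelSin K t * (c * (1 / s) * sin γ) := by
      linear_combination (-(c * (modelSin K s / s))) * e1
    rw [f3, mul_sub, e2, one_div] at this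
    norm_num
    linarith)
  filter_upwards [this] with r hr
  simp only [Pi.sub_apply, Pi.add_apply, Pi.mul_apply, Pi.pow_apply] at hr
  linarith

/-- The logarithmic barrier keeps the minimum away from the axes. -/
lemma exists_isMinOn_sub_log {f : ℝ × ℝ → ℝ} {a b c : ℝ} (ha : 0 < a) (hb : 0 < b) (hc : 0 < c)
    (hf : ∀ p, f p ∈ Icc 0 π) (hcont : ContinuousOn f (Ioc 0 a ×ˢ Ioc 0 b)) :
    ∃ p ∈ Ioc 0 a ×ˢ Ioc 0 b, ∀ q ∈ Ioc 0 a ×ˢ Ioc 0 b,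
      f p - c * (log p.1 + log p.2) ≤ f q - c * (log q.1 + log q.2) := by
  have hexp : exp (-(π / c)) ≤ 1 := exp_le_one_iff.2 (neg_nonpos.2 (by positivity))
  have hlog : ∀ x > 0, log (x * exp (-(π / c))) = log x - π / c := fun x hx => by
    rw [log_mul hx.ne' (exp_pos _).ne', log_exp]; ring
  have hc' : c * (π / c) = π := by field_simp
  have hsub : Icc (a * exp (-(π / c))) a ×ˢ Icc (b * exp (-(π / c))) b ⊆ Ioc 0 a ×ˢ Ioc 0 b :=
    prod_mono (fun x hx => ⟨lt_of_lt_of_le (by positivity) hx.1, hx.2⟩)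
      fun x hx => ⟨lt_of_lt_of_le (by positivity) hx.1, hx.2⟩
  have hab : (a, b) ∈ Icc (a * exp (-(π / c))) a ×ˢ Icc (b * exp (-(π / c))) b :=
    ⟨⟨mul_le_of_le_one_right ha.le hexp, le_rfl⟩, ⟨mul_le_of_le_one_right hb.le hexp, le_rfl⟩⟩
  have hg : ContinuousOn (fun p : ℝ × ℝ => f p - c * (log p.1 + log p.2))
      (Icc (a * exp (-(π / c))) a ×ˢ Icc (b * exp (-(π / c))) b) := by
    refine (hcont.mono hsub).sub (continuousOn_const.mul (ContinuousOn.add ?_ ?_))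
    · exact continuousOn_fst.log fun p hp => (hsub hp).1.1.ne'
    · exact continuousOn_snd.log fun p hp => (hsub hp).2.1.ne'
  obtain ⟨p, hp, hmin⟩ := (isCompact_Icc.prod isCompact_Icc).exists_isMinOn ⟨_, hab⟩ hg
  refine ⟨p, hsub hp, fun q hq => ?_⟩
  by_cases hq' : q ∈ Icc (a * exp (-(π / c))) a ×ˢ Icc (b * exp (-(π / c))) b
  · exact hmin hq'
  have h1 : f p - c * (log p.1 + log p.2) ≤ f (a, b) - c * (log a + log b) := hmin hab
  have h2 : log q.1 + log q.2 ≤ log a + log b - π / c := by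
    have l1 := log_le_log hq.1.1 hq.1.2
    have l2 := log_le_log hq.2.1 hq.2.2
    rcases lt_or_ge q.1 (a * exp (-(π / c))) with h | h
    · have := log_le_log hq.1.1 h.le
      rw [hlog a ha] at this; linarith
    rcases lt_or_ge q.2 (b * exp (-(π / c))) with h' | h'
    · have := log_le_log hq.2.1 h'.le
      rw [hlog b hb] at this; linarith
    exact absurd ⟨⟨h, hq.1.2⟩, ⟨h', hq.2.2⟩⟩ hq'
  have h3 := mul_le_mul_of_nonneg_left h2 hc.le
  rw [mul_sub, hc'] at h3
  linarith [(hf (a, b)).2, (hf q).1]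

section Comparison

variable {M : Type*} [MetricSpace M] {K : ℝ}

/-- The comparison angle `∡_K (l s) (l 0) (n t)` for shortests `l` and `n` with the same origin, as
a function of the arc length parameters. -/
noncomputable def arcAngle (K : ℝ) (l n : ℝ → M) (s t : ℝ) : ℝ :=
  modelAngle K s t (dist (l s) (n t))

lemma IsReDomain.isModelTriangle_arc (hM : IsReDomain K M) {l n : ℝ → M} {a b s t : ℝ}
    (hl : IsUnitSpeed l a) (hn : IsUnitSpeed n b) (h0 : n 0 = l 0) (hs : s ∈ Ioc 0 a)
    (ht : t ∈ Ioc 0 b) : IsModelTriangle K s t (dist (l s) (n t)) := by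
  have e1 := hl.dist_zero_left ⟨hs.1.le, hs.2⟩
  have e2 := hn.dist_zero_left ⟨ht.1.le, ht.2⟩
  rw [h0] at e2
  have := hM.isModelTriangle (X := l s) (O := l 0) (Y := n t)
    (dist_pos.1 (by rw [e1]; exact hs.1)) (dist_pos.1 (by rw [e2]; exact ht.1))
  rwa [e1, e2] at this

lemma IsUnitSpeed.continuousOn {l : ℝ → M} {a : ℝ} (hl : IsUnitSpeed l a) :
    ContinuousOn l (Icc 0 a) := by
  refine (LipschitzOnWith.of_dist_le_mul (K := 1) fun s hs t ht => ?_).continuousOn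
  rw [hl s hs t ht, Real.dist_eq, NNReal.coe_one, one_mul]

lemma IsReDomain.continuousOn_arcAngle (hM : IsReDomain K M) (hK : K ≠ 0) {l n : ℝ → M} {a b : ℝ}
    (hl : IsUnitSpeed l a) (hn : IsUnitSpeed n b) (h0 : n 0 = l 0) :
    ContinuousOn (fun p : ℝ × ℝ => arcAngle K l n p.1 p.2) (Ioc 0 a ×ˢ Ioc 0 b) := by
  have hc := continuous_modelCos hK
  have hs := continuous_modelSin hK
  simp only [arcAngle, modelAngle_eq_arccos hK]
  refine continuous_arccos.comp_continuousOn (ContinuousOn.div ?_ (by fun_prop) fun p hp => ?_)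
  · have h1 : ContinuousOn (fun p : ℝ × ℝ => l p.1) (Ioc 0 a ×ˢ Ioc 0 b) :=
      hl.continuousOn.comp continuousOn_fst fun p hp => ⟨hp.1.1.le, hp.1.2⟩
    have h2 : ContinuousOn (fun p : ℝ × ℝ => n p.2) (Ioc 0 a ×ˢ Ioc 0 b) :=
      hn.continuousOn.comp continuousOn_snd fun p hp => ⟨hp.2.1.le, hp.2.2⟩
    exact (hc.comp_continuousOn (continuous_dist.comp_continuousOn (h1.prodMk h2))).sub (by fun_prop)
  · have ht := hM.isModelTriangle_arc hl hn h0 hp.1 hp.2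
    exact mul_ne_zero (mul_ne_zero hK (ht.modelSin_left_pos hK).ne') (ht.modelSin_right_pos hK).ne'

/-- Two shortests from the same point that meet again make the angle zero there. This follows from
the excess inequality for the triangle formed by the two common points and the midpoint of one of
the two arcs: at the midpoint, both the angle and the comparison angle are equal to `π`. -/
lemma IsReDomain.upperAngle_nonpos_of_eq (hM : IsReDomain K M) (hK : K ≠ 0) {l n : ℝ → M} {s : ℝ}
    (hs : 0 < s) (hl : IsUnitSpeed l s) (hn : IsUnitSpeed n s) (h0 : n 0 = l 0) (h1 : l s = n s) :
    upperAngle K (l 0) (l '' Icc 0 s) (n '' Icc 0 s) ≤ 0 := by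
  have hs2 : 0 < s / 2 := by linarith
  have hs3 : s / 2 ≤ s := by linarith
  have m0 : (0 : ℝ) ∈ Icc 0 s := ⟨le_rfl, hs.le⟩
  have m1 : s ∈ Icc 0 s := ⟨hs.le, le_rfl⟩
  have m2 : s / 2 ∈ Icc 0 s := ⟨hs2.le, hs3⟩
  have hl1 : IsUnitSpeed l (s / 2) := hl.mono hs3
  have hr : IsUnitSpeed (fun t => l (s / 2 - t)) (s / 2) := hl.reverse hs3
  have hm : IsUnitSpeed (fun t => l (s / 2 + t)) (s / 2) := by
    have := hl.shift hs2.le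
    rwa [sub_half] at this
  have dA : dist (l 0) (l (s / 2)) = s / 2 := hl.dist_zero_left m2
  have dB : dist (l (s / 2)) (n s) = s / 2 := by
    rw [← h1, hl _ m2 _ m1, abs_of_nonpos] <;> linarith
  have dC : dist (l 0) (n s) = s := by rw [← h1]; exact hl.dist_zero_left m1
  have hAB : l 0 ≠ l (s / 2) := dist_pos.1 (by rw [dA]; exact hs2)
  have hBC : l (s / 2) ≠ n s := dist_pos.1 (by rw [dB]; exact hs2)
  have hAC : l 0 ≠ n s := dist_pos.1 (by rw [dC]; exact hs)
  have sBC : IsShortest ((fun t => l (s / 2 + t)) '' Icc 0 (s / 2)) (l (s / 2)) (n s) := by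
    have := hm.isShortest hs2.le
    simpa [← h1] using this
  have sCA : IsShortest (n '' Icc 0 s) (n s) (l 0) := by
    rw [← h0]; exact hn.isShortest_symm hs.le
  have hex := hM.excess_nonpos ⟨l 0, l (s / 2), n s, l '' Icc 0 (s / 2),
    (fun t => l (s / 2 + t)) '' Icc 0 (s / 2), n '' Icc 0 s, hAB, hBC, hAC.symm,
    hl1.isShortest hs2.le, sBC, sCA⟩
  simp only [GeodesicTriangle.excess] at hex
  rw [hl.upperAngle_eq K hs2 hs3 hn hs le_rfl h0] at hex
  have hzero : comparisonAngle K (l (s / 2)) (l 0) (n s) = 0 := by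
    have htri := hM.isModelTriangle hAB hAC
    rw [dA, dB, dC] at htri
    have := IsModelTriangle.eq_zero_of_sub (y := s) (x := s / 2) hK (by rwa [sub_half])
    rw [comparisonAngle, dA, dB, dC]
    rwa [sub_half] at this
  have hzero' : comparisonAngle K (l 0) (n s) (l (s / 2)) = 0 := by
    rw [comparisonAngle, modelAngle_comm, dist_comm _ (l 0), dist_comm _ (l (s / 2)), dA, dB, dC]
    rwa [comparisonAngle, dA, dB, dC] at hzero
  have hpi : comparisonAngle K (l 0) (l (s / 2)) (n s) ≤ π := modelAngle_le_pi _ _ _ _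
  have hC : 0 ≤ upperAngle K (n s) ((fun t => l (s / 2 + t)) '' Icc 0 (s / 2)) (n '' Icc 0 s) := by
    have := ((hm.reverse le_rfl).upperAngle_mem_Icc K hs2 (hn.reverse le_rfl) hs (by simp [h1])).1
    simp only [image_reverse_Icc n s, image_reverse_Icc (fun t => l (s / 2 + t)) (s / 2)] at this
    simpa [h1] using this
  have hB : upperAngle K (l (s / 2)) (l '' Icc 0 (s / 2))
      ((fun t => l (s / 2 + t)) '' Icc 0 (s / 2)) = π := by
    have hmem := hr.upperAngle_mem_Icc K hs2 hm hs2 (by simp)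
    have hfv := fun ε (hε : 0 < ε) => hM.first_variation hK hr hs2 hm hs2 (by simp) hε
    simp only [image_reverse_Icc, sub_zero, add_halves] at hmem hfv
    set ξ := upperAngle K (l (s / 2)) (l '' Icc 0 (s / 2))
      ((fun t => l (s / 2 + t)) '' Icc 0 (s / 2))
    have hle : cos ξ ≤ -1 := by
      refine le_of_forall_pos_le_add fun ε hε => ?_
      obtain ⟨h, hh, hh'⟩ := ((hfv ε hε).and (Ioc_mem_nhdsGT hs2)).exists
      rw [hl _ ⟨by linarith [hh'.2], by linarith [hh'.1]⟩ _ m1,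
        abs_of_nonpos (by linarith [hh'.1])] at hh
      have : h * (cos ξ - ε) ≤ h * (-1) := by linarith
      linarith [le_of_mul_le_mul_left this hh'.1]
    exact injOn_cos hmem ⟨pi_pos.le, le_rfl⟩
      (by rw [cos_pi]; exact le_antisymm hle (neg_one_le_cos ξ))
  linarith

/-- If moving `l s` towards `l 0` by `r` decreases the comparison angle at `l 0` by at most
`c * log (s / (s - r))`, then the upper angle at `l s` is at least the comparison angle there, up to
an error of order `c`. -/
lemma IsReDomain.cos_sub_cos_le (hM : IsReDomain K M) (hK : K ≠ 0) {l n m : ℝ → M}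
    {a b s t c : ℝ} (hl : IsUnitSpeed l a) (hn : IsUnitSpeed n b) (h0 : n 0 = l 0)
    (hs : s ∈ Ioc 0 a) (ht : t ∈ Ioc 0 b) (hz : 0 < dist (l s) (n t))
    (hm : IsUnitSpeed m (dist (l s) (n t))) (hm0 : m 0 = l s) (hm1 : m (dist (l s) (n t)) = n t)
    (hc : 0 < c)
    (hmin : ∀ r ∈ Ioo 0 s, arcAngle K l n s t - c * (log s - log (s - r))
      ≤ arcAngle K l n (s - r) t) :
    cos (upperAngle K (l s) (l '' Icc 0 s) (m '' Icc 0 (dist (l s) (n t))))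
        - cos (modelAngle K s (dist (l s) (n t)) t)
      ≤ c * (modelSin K s / s) * sin (modelAngle K s (dist (l s) (n t)) t) := by
  have htri := hM.isModelTriangle_arc hl hn h0 hs ht
  set z := dist (l s) (n t) with hzdef
  set ξ := upperAngle K (l s) (l '' Icc 0 s) (m '' Icc 0 z)
  refine le_of_forall_pos_lt_add fun ε hε => ?_
  by_contra! hcon
  have hr := hl.reverse hs.2
  have hfv := hM.first_variation hK hr hs.1 hm hz (by simpa using hm0) (half_pos hε)
  simp only [image_reverse_Icc, sub_zero, hm1] at hfv
  have hcont : Tendsto (fun r : ℝ => kappa K * (z - r * (cos ξ - ε / 2))) (𝓝[>] 0)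
      (𝓝 (kappa K * z)) := by
    have : Continuous fun r : ℝ => kappa K * (z - r * (cos ξ - ε / 2)) := by fun_prop
    have := this.tendsto 0
    rw [zero_mul, sub_zero] at this
    exact this.mono_left nhdsWithin_le_nhds
  have hsmall : ∀ᶠ r in 𝓝[>] 0, 0 < K → kappa K * (z - r * (cos ξ - ε / 2)) < π := by
    by_cases hK' : 0 < K
    · exact (hcont.eventually (gt_mem_nhds (htri.kappa_third_lt hK'))).mono fun _ h _ => h
    · exact Eventually.of_forall fun _ h => absurd h hK'
  have hIoo : ∀ᶠ r in 𝓝[>] 0, r ∈ Ioo 0 s := Ioo_mem_nhdsGT hs.1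
  obtain ⟨r, hr1, hr2, hr3, hr4⟩ := (hfv.and (hsmall.and (hIoo.and
    (htri.eventually_pos (k := cos ξ - ε / 2) (c := c) hK hz (by linarith))))).exists
  have htri' := hM.isModelTriangle_arc hl hn h0 (s := s - r) (t := t)
    ⟨by linarith [hr3.2], by linarith [hr3.1, hs.2]⟩ ht
  have hlaw := htri'.law_of_cosines hK
  have hmono := modelCos_div_le hK dist_nonneg hr1 fun hK' => by
    have := htri'.kappa_third_lt hK'
    have := hr2 hK'
    rw [mul_add]; linarith
  have hlog : 0 ≤ c * (log s - log (s - r)) :=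
    mul_nonneg hc.le (sub_nonneg.2 (log_le_log (by linarith [hr3.2]) (by linarith [hr3.1])))
  have hcos := cos_le_of_sub_le ⟨modelAngle_nonneg _ _ _ _, modelAngle_le_pi _ _ _ _⟩
    ⟨modelAngle_nonneg _ _ _ _, modelAngle_le_pi _ _ _ _⟩ hlog (hmin r hr3)
  have := mul_le_mul_of_nonneg_left hcos
    (mul_pos (htri'.modelSin_left_pos hK) (htri'.modelSin_right_pos hK)).le
  linarith

/-- Aleksandrov's angle comparison: upper angles are at most the comparison angles. -/
theorem IsReDomain.upperAngle_le (hM : IsReDomain K M) (hK : K ≠ 0) {l n : ℝ → M} {a b : ℝ}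
    (ha : 0 < a) (hb : 0 < b) (hl : IsUnitSpeed l a) (hn : IsUnitSpeed n b) (h0 : n 0 = l 0) :
    upperAngle K (l 0) (l '' Icc 0 a) (n '' Icc 0 b) ≤ modelAngle K a b (dist (l a) (n b)) := by
  obtain ⟨Λ, hΛ, hlin⟩ := exists_modelSin_le hK (max a b)
  refine le_of_forall_pos_le_add fun ε hε => ?_
  set c := ε / (4 * Λ) with hcdef
  have hc : 0 < c := by positivity
  obtain ⟨⟨s, t⟩, ⟨hs, ht⟩, hmin⟩ := exists_isMinOn_sub_log ha hb hc
    (f := fun p => arcAngle K l n p.1 p.2)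
    (fun p => ⟨modelAngle_nonneg _ _ _ _, modelAngle_le_pi _ _ _ _⟩)
    (hM.continuousOn_arcAngle hK hl hn h0)
  simp only at hs ht hmin
  have htri := hM.isModelTriangle_arc hl hn h0 hs ht
  have hle : arcAngle K l n s t ≤ modelAngle K a b (dist (l a) (n b)) := by
    have h1 := hmin (a, b) ⟨⟨ha, le_rfl⟩, ⟨hb, le_rfl⟩⟩
    have h2 := mul_le_mul_of_nonneg_left (add_le_add (log_le_log hs.1 hs.2)
      (log_le_log ht.1 ht.2)) hc.le
    simp only at h1
    change _ ≤ arcAngle K l n a b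
    linarith
  have hl' := hl.mono hs.2
  have hn' := hn.mono ht.2
  have hα := hl.upperAngle_eq K hs.1 hs.2 hn ht.1 ht.2 h0
  rw [← hα]
  rcases (dist_nonneg (x := l s) (y := n t)).eq_or_lt with hz | hz
  · have hst : s = t := le_antisymm (by linarith [htri.left_le]) (by linarith [htri.right_le])
    subst hst
    linarith [hM.upperAngle_nonpos_of_eq hK hs.1 hl' hn' h0 (dist_eq_zero.1 hz.symm),
      modelAngle_nonneg K a b (dist (l a) (n b))]
  obtain ⟨m, hm, hm0, hm1⟩ := hM.exists_isUnitSpeed (l s) (n t)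
  set z := dist (l s) (n t) with hzdef
  have hz' : dist (n t) (l s) = z := dist_comm _ _
  have hmr := hm.reverse le_rfl
  -- The two first variation inequalities at the minimum.
  have h1 := hM.cos_sub_cos_le hK hl hn h0 hs ht hz hm hm0 hm1 hc fun r hr => by
    have := hmin (s - r, t) ⟨⟨by linarith [hr.2], by linarith [hr.1, hs.2]⟩, ht⟩
    simp only at this
    linarith
  have h2 := hM.cos_sub_cos_le (m := fun r => m (z - r)) hK hn hl h0.symm ht hs
    (by rw [hz']; exact hz) (by rw [hz']; exact hmr) (by simpa using hm1)
    (by rw [hz', sub_self]; exact hm0) hc fun r hr => by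
    have := hmin (s, t - r) ⟨hs, ⟨by linarith [hr.2], by linarith [hr.1, ht.2]⟩⟩
    simp only [arcAngle] at this ⊢
    rw [modelAngle_comm K t, modelAngle_comm K (t - r), dist_comm (n t), dist_comm (n (t - r))]
    linarith
  rw [hz', image_reverse_Icc] at h2
  have dA : dist (l 0) (l s) = s := hl.dist_zero_left ⟨hs.1.le, hs.2⟩
  have dC : dist (l 0) (n t) = t := by rw [← h0]; exact hn.dist_zero_left ⟨ht.1.le, ht.2⟩
  have hBm := (hl'.reverse le_rfl).upperAngle_mem_Icc K hs.1 hm hz (by simpa using hm0)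
  have hCm := (hn'.reverse le_rfl).upperAngle_mem_Icc K ht.1 hmr hz (by simpa using hm1)
  simp only [image_reverse_Icc, sub_zero] at hBm hCm
  have hlin' : ∀ x ∈ Ioc 0 (max a b), modelSin K x / x ≤ Λ := fun x hx =>
    (div_le_iff₀ hx.1).2 (hlin x ⟨hx.1.le, hx.2⟩)
  have hB := sub_le_two_mul_of_cos_sub_cos_le hBm
    ⟨modelAngle_nonneg K s z t, modelAngle_le_pi _ _ _ _⟩ (c := c * Λ) (by positivity)
    (h1.trans (mul_le_mul_of_nonneg_right (mul_le_mul_of_nonneg_left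
      (hlin' s ⟨hs.1, hs.2.trans (le_max_left _ _)⟩) hc.le)
      (sin_nonneg_of_nonneg_of_le_pi (modelAngle_nonneg _ _ _ _) (modelAngle_le_pi _ _ _ _))))
  have hC := sub_le_two_mul_of_cos_sub_cos_le hCm
    ⟨modelAngle_nonneg K t z s, modelAngle_le_pi _ _ _ _⟩ (c := c * Λ) (by positivity)
    (h2.trans (mul_le_mul_of_nonneg_right (mul_le_mul_of_nonneg_left
      (hlin' t ⟨ht.1, ht.2.trans (le_max_right _ _)⟩) hc.le)
      (sin_nonneg_of_nonneg_of_le_pi (modelAngle_nonneg _ _ _ _) (modelAngle_le_pi _ _ _ _))))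
  have sBC : IsShortest (m '' Icc 0 z) (l s) (n t) := by
    have := hm.isShortest hz.le
    rwa [hm0, hm1] at this
  have sCA : IsShortest (n '' Icc 0 t) (n t) (l 0) := by
    rw [← h0]; exact hn'.isShortest_symm ht.1.le
  have hex := hM.excess_nonpos ⟨l 0, l s, n t, l '' Icc 0 s, m '' Icc 0 z, n '' Icc 0 t,
    dist_pos.1 (by rw [dA]; exact hs.1), dist_pos.1 hz,
    (dist_pos.1 (by rw [dC]; exact ht.1)).symm, hl'.isShortest hs.1.le, sBC, sCA⟩
  simp only [GeodesicTriangle.excess, comparisonAngle] at hex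
  rw [dist_comm (l s) (l 0), dist_comm (n t) (l 0), hz', dA, dC, ← hzdef,
    upperAngle_comm K (n t)] at hex
  have hcΛ : 4 * (c * Λ) = ε := by rw [hcdef]; field_simp
  have harc : arcAngle K l n s t = modelAngle K s t z := rfl
  linarith

end Comparison

/-! ### The median inequality and the Euler inequality -/

section Median

variable {M : Type*} [MetricSpace M] {K : ℝ}

/-- The comparison angles between a shortest `Q P` and the two halves of a shortest `B D` with
midpoint `P` add up to at least `π`. The upper angles do, because for `Y` on the shortest from `P`
to `Q` the first variation inequality bounds `dist B Y + dist Y D ≥ dist B D`. -/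
lemma IsReDomain.cos_add_cos_nonpos (hM : IsReDomain K M) (hK : K ≠ 0) {P Q B D : M}
    (hQ : P ≠ Q) (hB : P ≠ B) (hD : P ≠ D) (h : dist P B + dist P D = dist B D) :
    cos (comparisonAngle K Q P B) + cos (comparisonAngle K Q P D) ≤ 0 := by
  obtain ⟨l, hl, hl0, hl1⟩ := hM.exists_isUnitSpeed P Q
  have hq := dist_pos.2 hQ
  have key : ∀ X, P ≠ X → ∀ ε > 0, ∀ᶠ r in 𝓝[>] 0,
      dist (l r) X ≤ dist P X - r * (cos (comparisonAngle K Q P X) - ε) := by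
    intro X hX ε hε
    obtain ⟨n, hn, hn0, hn1⟩ := hM.exists_isUnitSpeed P X
    have hx := dist_pos.2 hX
    have h0 : n 0 = l 0 := hn0.trans hl0.symm
    have hang := hM.upperAngle_le hK hq hx hl hn h0
    have hmem := hl.upperAngle_mem_Icc K hq hn hx h0
    have hcos := cos_le_cos_of_nonneg_of_le_pi hmem.1 (modelAngle_le_pi _ _ _ _) hang
    rw [hl1, hn1] at hcos
    filter_upwards [hM.first_variation hK hl hq hn hx h0 hε, self_mem_nhdsWithin] with r hr hr0
    rw [hn1] at hr
    refine hr.trans ?_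
    rw [comparisonAngle]
    nlinarith [mem_Ioi.1 hr0]
  refine le_of_forall_pos_le_add fun ε hε => ?_
  obtain ⟨r, hrB, hrD, hr⟩ := ((key B hB _ (half_pos hε)).and ((key D hD _ (half_pos hε)).and
    self_mem_nhdsWithin)).exists
  have htri := dist_triangle_left B D (l r)
  have : r * (cos (comparisonAngle K Q P B) + cos (comparisonAngle K Q P D)) ≤ r * (0 + ε) := by
    linarith
  exact le_of_mul_le_mul_left this hr

/-- Comparison of medians: the distance from `Q` to the midpoint `P` of a shortest `B D` is at most
the corresponding median of the comparison triangle. -/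
lemma IsReDomain.median (hM : IsReDomain K M) (hK : K ≠ 0) {P B D : M} (Q : M) (hBD : B ≠ D)
    (hB : dist P B = dist B D / 2) (hD : dist P D = dist B D / 2) :
    modelCos K (dist Q B) / K + modelCos K (dist Q D) / K
      ≤ 2 * modelCos K (dist B D / 2) * modelCos K (dist P Q) / K := by
  have he := dist_pos.2 hBD
  rcases eq_or_ne P Q with rfl | hQ
  · rw [hB, hD, dist_self, modelCos_zero]
    apply le_of_eq; ring
  have hPB : P ≠ B := dist_pos.1 (by rw [hB]; linarith)
  have hPD : P ≠ D := dist_pos.1 (by rw [hD]; linarith)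
  have hsum := hM.cos_add_cos_nonpos hK hQ hPB hPD (by rw [hB, hD]; ring)
  have tB := hM.isModelTriangle hQ hPB
  have tD := hM.isModelTriangle hQ hPD
  have lB := tB.law_of_cosines hK
  have lD := tD.law_of_cosines hK
  have hp := mul_pos (tB.modelSin_left_pos hK) (tB.modelSin_right_pos hK)
  rw [comparisonAngle, comparisonAngle] at hsum
  rw [hB] at lB hp hsum
  rw [hD] at lD hsum
  have := mul_le_mul_of_nonneg_left hsum hp.le
  rw [lB, lD, mul_zero, mul_add] at *
  have e : 2 * modelCos K (dist B D / 2) * modelCos K (dist P Q) / K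
      = 2 * (modelCos K (dist P Q) * modelCos K (dist B D / 2) / K) := by ring
  rw [e]
  linarith

lemma IsReDomain.exists_midpoint (hM : IsReDomain K M) (B D : M) :
    ∃ P : M, dist P B = dist B D / 2 ∧ dist P D = dist B D / 2 := by
  obtain ⟨l, hl, h0, h1⟩ := hM.exists_isUnitSpeed B D
  have hd : (0 : ℝ) ≤ dist B D := dist_nonneg
  have hm : dist B D / 2 ∈ Icc 0 (dist B D) := ⟨by linarith, by linarith⟩
  refine ⟨l (dist B D / 2), ?_, ?_⟩
  · have := hl.dist_zero_left hm
    rwa [h0, dist_comm] at this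
  · have := hl _ hm _ ⟨hd, le_rfl⟩
    rw [h1] at this
    rw [this, abs_of_nonpos] <;> linarith

end Median

theorem mainTheorem7 (K : ℝ) (hK : K ≠ 0) {M : Type*} [MetricSpace M] (hM : IsReDomain K M)
    (A B C D : M) (hAB : A ≠ B) (hAC : A ≠ C) (hAD : A ≠ D) (hBC : B ≠ C) (hBD : B ≠ D)
    (hCD : C ≠ D)
    (hper : 0 < K → dist A B + dist B C + dist C D + dist D A < 2 * π / √K) :
    (0 < K →
      cos (kappa K * dist A B) + cos (kappa K * dist B C) + cos (kappa K * dist C D)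
          + cos (kappa K * dist D A)
        ≤ 4 * cos (kappa K * (dist B D / 2)) * cos (kappa K * (dist A C / 2))) ∧
    (K < 0 →
      4 * cosh (kappa K * (dist B D / 2)) * cosh (kappa K * (dist A C / 2))
        ≤ cosh (kappa K * dist A B) + cosh (kappa K * dist B C) + cosh (kappa K * dist C D)
          + cosh (kappa K * dist D A)) := by
  obtain ⟨P, hPB, hPD⟩ := hM.exists_midpoint B D
  have hA := hM.median hK A hBD hPB hPD
  have hC := hM.median hK C hBD hPB hPD
  have hk := kappa_pos hK
  have htri := dist_triangle_left A C P
  rw [dist_comm A D] at hA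
  rw [dist_comm C B] at hC
  -- `u` and `v` are the half sum and the half difference of the distances from `P` to `A` and `C`
  obtain ⟨u, hu⟩ : ∃ u, u = kappa K * (dist P A + dist P C) / 2 := ⟨_, rfl⟩
  obtain ⟨v, hv⟩ : ∃ v, v = kappa K * (dist P A - dist P C) / 2 := ⟨_, rfl⟩
  have e1 : kappa K * dist P A = u + v := by rw [hu, hv]; ring
  have e2 : kappa K * dist P C = u - v := by rw [hu, hv]; ring
  have hfu : kappa K * (dist A C / 2) ≤ u := by rw [hu]; nlinarith
  have hf0 : 0 ≤ kappa K * (dist A C / 2) := by positivity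
  constructor
  · intro hK0
    rw [← add_div, div_le_div_iff_of_pos_right hK0] at hA hC
    simp only [modelCos, if_pos hK0, e1, e2, cos_add, cos_sub] at hA hC
    have bA := hM.kappa_mul_dist_lt hK0 P A
    have bC := hM.kappa_mul_dist_lt hK0 P C
    have bf := hM.kappa_mul_dist_lt hK0 A C
    have be := hM.kappa_mul_dist_lt hK0 B D
    have he0 : 0 ≤ cos (kappa K * (dist B D / 2)) :=
      cos_nonneg_of_neg_pi_div_two_le_of_le
        (by have : 0 ≤ kappa K * (dist B D / 2) := by positivity
            linarith [pi_pos]) (by linarith)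
    have hcf : 0 ≤ cos (kappa K * (dist A C / 2)) :=
      cos_nonneg_of_neg_pi_div_two_le_of_le (by linarith [pi_pos]) (by linarith)
    have hcu : cos u ≤ cos (kappa K * (dist A C / 2)) :=
      cos_le_cos_of_nonneg_of_le_pi hf0 (by linarith) hfu
    have hv1 : |v| ≤ π / 2 := by
      have p1 : 0 ≤ kappa K * dist P A := by positivity
      have p2 : 0 ≤ kappa K * dist P C := by positivity
      exact abs_le.2 ⟨by linarith, by linarith⟩
    have hcv : 0 ≤ cos v := cos_nonneg_of_neg_pi_div_two_le_of_le (abs_le.1 hv1).1 (abs_le.1 hv1).2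
    have huv : cos u * cos v ≤ cos (kappa K * (dist A C / 2)) :=
      (mul_le_mul_of_nonneg_right hcu hcv).trans (mul_le_of_le_one_right hcf (cos_le_one v))
    have := mul_le_mul_of_nonneg_left huv he0
    linarith
  · intro hK0
    rw [← add_div, div_le_div_right_of_neg hK0] at hA hC
    simp only [modelCos, if_neg hK0.not_gt, e1, e2, cosh_add, cosh_sub] at hA hC
    have hcu : cosh (kappa K * (dist A C / 2)) ≤ cosh u :=
      cosh_le_cosh.2 (by rwa [abs_of_nonneg hf0, abs_of_nonneg (hf0.trans hfu)])
    have huv : cosh (kappa K * (dist A C / 2)) ≤ cosh u * cosh v :=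
      hcu.trans (le_mul_of_one_le_right (cosh_pos u).le (one_le_cosh v))
    have := mul_le_mul_of_nonneg_left huv (cosh_pos (kappa K * (dist B D / 2))).le
    linarith
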